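/- **Theorem (entanglement cost of sequences of bipartite pure states).** For $n=1,2,\dots$ let $|\phi_n\rangle\in\mathcal H_A^{(n)}\otimes\mathcal H_B^{(n)}$ be a unit vector, where $\mathcal H_A^{(n)},\mathcal H_B^{(n)}$ are arbitrary finite-dimensional Hilbert spaces, let $\phi_n=|\phi_n\rangle\langle\phi_n|$, and let $\rho_n=\mathrm{Tr}_A\,\phi_n$. Then $$E_C=\overline S(\rho)\quad\text{in }[0,+\infty],$$ where the two sides are defined as follows. *Entanglement cost.* Let $|\Psi^+_M\rangle=M^{-1/2}\sum_{i=1}^M|i\rangle|i\rangle\in\mathbb C^M\otimes\mathbb C^M$ be the maximally entangled state of rank $M$. A real number $R$ is an achievable dilution rate if for every $\varepsilon>0$ there is $N$ such that for every $n\ge N$ there are an integer $M_n\ge1$ with $\frac1n\log M_n\le R$ and an LOCC transformation $\mathcal T_n$ from operators on $\mathbb C^{M_n}\otimes\mathbb C^{M_n}$ to operators on $\mathcal H_A^{(n)}\otimes\mathcal H_B^{(n)}$ with $$\langle\phi_n|\,\mathcal T_n\big(|\Psi^+_{M_n}\rangle\langle\Psi^+_{M_n}|\big)\,|\phi_n\rangle\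 \ge\ 1-\varepsilon .$$ $E_C$ is the infimum of all achievable dilution rates ($+\infty$ if there are none). The identity holds for each of the following three classes of LOCC transformations: local operations with one-way classical communication from $A$ to $B$, with one-way classical communication from $B$ to $A$, and with two-way classical communication (finitely many rounds). *Sup-spectral entropy rate.* For a self-adjoint operator $X$ let $\{X\ge0\}$ be the projection onto the span of the eigenvectors of $X$ with non-negative eigenvalues. With $\Pi_n(\gamma)=\rho_n-e^{n\gamma}I$, $$\overline S(\rho)=-\sup\Big\{\gamma\in\mathbb R:\ \liminf_{n\to\infty}\mathrm{Tr}\big[\{\Pi_n(\gamma)\ge0\}\,\Pi_n(\gamma)\big]=1\Big\},$$ which is $+\infty$ if the set is empty. -/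

import Mathlib

open scoped Matrix Kronecker

namespace EntDilution

noncomputable section

/-- Operators on the Hilbert space `ℂ^a ⊗ ℂ^b` of a bipartite system, as matrices in the
product basis. -/
abbrev BiOp (a b : ℕ) : Type := Matrix (Fin a × Fin b) (Fin a × Fin b) ℂ

/-- Vectors of the Hilbert space `ℂ^a ⊗ ℂ^b`. -/
abbrev BiVec (a b : ℕ) : Type := EuclideanSpace ℂ (Fin a × Fin b)

/-- The rank-one operator `|φ⟩⟨φ|`. -/
def proj {a b : ℕ} (φ : BiVec a b) : BiOp a b :=
  Matrix.of fun x y => φ x * star (φ y)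

/-- The partial trace over the first party `A`. -/
def traceA {a b : ℕ} (X : BiOp a b) : Matrix (Fin b) (Fin b) ℂ :=
  Matrix.of fun j l => ∑ i, X (i, j) (i, l)

/-- The maximally entangled vector `M^{-1/2} ∑ i, |i⟩|i⟩` of rank `M` in `ℂ^M ⊗ ℂ^M`. -/
def maxEntangled (M : ℕ) : BiVec M M :=
  WithLp.toLp 2 fun x => if x.1 = x.2 then (((Real.sqrt M)⁻¹ : ℝ) : ℂ) else 0

/-- The fidelity `⟨φ|σ|φ⟩ = Tr[σ |φ⟩⟨φ|]` of an output state `σ` with a pure target `φ`. -/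
def fidelity {a b : ℕ} (σ : BiOp a b) (φ : BiVec a b) : ℝ :=
  (Matrix.trace (σ * proj φ)).re

/-! Classes of entanglement manipulations. A map from operators on `ℂ^a ⊗ ℂ^b` to operators on
`ℂ^a' ⊗ ℂ^b'` is given by local quantum instruments (in Kraus form, the local dimensions being
allowed to change, so that local ancillas and partial traces are included) whose later steps may
depend on the communicated outcomes of earlier ones. -/

/-- Local operations with one-way communication from `A` to `B`: `A` measures with Kraus
operators `K i`, and `B`, on learning `i`, applies the channel with Kraus operators `L i j`. -/
def IsForwardLOCC {a b a' b' : ℕ} (T : BiOp a b → BiOp a' b') : Prop :=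
  ∃ (m k : ℕ) (K : Fin m → Matrix (Fin a') (Fin a) ℂ)
    (L : Fin m → Fin k → Matrix (Fin b') (Fin b) ℂ),
    (∑ i, (K i)ᴴ * K i = 1) ∧ (∀ i, ∑ j, (L i j)ᴴ * L i j = 1) ∧
    ∀ ρ, T ρ = ∑ i, ∑ j, (K i ⊗ₖ L i j) * ρ * (K i ⊗ₖ L i j)ᴴ

/-- Local operations with one-way communication from `B` to `A`. -/
def IsBackwardLOCC {a b a' b' : ℕ} (T : BiOp a b → BiOp a' b') : Prop :=
  ∃ (m k : ℕ) (L : Fin m → Matrix (Fin b') (Fin b) ℂ)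
    (K : Fin m → Fin k → Matrix (Fin a') (Fin a) ℂ),
    (∑ i, (L i)ᴴ * L i = 1) ∧ (∀ i, ∑ j, (K i j)ᴴ * K i j = 1) ∧
    ∀ ρ, T ρ = ∑ i, ∑ j, (K i j ⊗ₖ L i) * ρ * (K i j ⊗ₖ L i)ᴴ

/-- Local operations with two-way classical communication (finitely many rounds): in each round
one of the parties performs a local measurement and announces the outcome, on which the whole
remaining protocol may depend. -/
inductive IsLOCC {a' b' : ℕ} : ∀ {a b : ℕ}, (BiOp a b → BiOp a' b') → Prop
  | finish : IsLOCC (a := a') (b := b') (fun ρ => ρ)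
  | alice {a b m : ℕ} (c : Fin m → ℕ) (K : ∀ i, Matrix (Fin (c i)) (Fin a) ℂ)
      (hK : ∑ i, (K i)ᴴ * K i = 1)
      (T : ∀ i, BiOp (c i) b → BiOp a' b') (hT : ∀ i, IsLOCC (T i)) :
      IsLOCC (a := a) (b := b) fun ρ =>
        ∑ i, T i ((K i ⊗ₖ (1 : Matrix (Fin b) (Fin b) ℂ)) * ρ *
          (K i ⊗ₖ (1 : Matrix (Fin b) (Fin b) ℂ))ᴴ)
  | bob {a b m : ℕ} (c : Fin m → ℕ) (L : ∀ i, Matrix (Fin (c i)) (Fin b) ℂ)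
      (hL : ∑ i, (L i)ᴴ * L i = 1)
      (T : ∀ i, BiOp a (c i) → BiOp a' b') (hT : ∀ i, IsLOCC (T i)) :
      IsLOCC (a := a) (b := b) fun ρ =>
        ∑ i, T i (((1 : Matrix (Fin a) (Fin a) ℂ) ⊗ₖ L i) * ρ *
          ((1 : Matrix (Fin a) (Fin a) ℂ) ⊗ₖ L i)ᴴ)

/-- The direction of classical communication that accompanies the local operations. -/
inductive Communication
  | forward
  | backward
  | twoWay

/-- The LOCC transformations with the given direction of communication. -/
def Communication.Allows (c : Communication) {a b a' b' : ℕ} (T : BiOp a b → BiOp a' b') : Prop :=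
  match c with
  | .forward => IsForwardLOCC T
  | .backward => IsBackwardLOCC T
  | .twoWay => IsLOCC T

/-- `R` is an achievable dilution rate for the sequence of bipartite pure target states `φ n`:
for every `ε > 0` and all large `n`, some allowed transformation takes a maximally entangled
state of some rank `M ≥ 1` with `(1 / n) log M ≤ R` to `φ n` with fidelity at least `1 - ε`. -/
def IsAchievableDilutionRate (c : Communication) {a b : ℕ → ℕ} (φ : ∀ n, BiVec (a n) (b n))
    (R : ℝ) : Prop :=
  ∀ ε : ℝ, 0 < ε → ∃ N : ℕ, ∀ n : ℕ, 1 ≤ n → N ≤ n →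
    ∃ M : ℕ, 1 ≤ M ∧ (1 / (n : ℝ)) * Real.log M ≤ R ∧
      ∃ T : BiOp M M → BiOp (a n) (b n),
        c.Allows T ∧ 1 - ε ≤ fidelity (T (proj (maxEntangled M))) (φ n)

/-- The entanglement cost: the infimum of the achievable dilution rates (`+∞` if there are none). -/
def entanglementCost (c : Communication) {a b : ℕ → ℕ} (φ : ∀ n, BiVec (a n) (b n)) : EReal :=
  sInf {x | ∃ R : ℝ, IsAchievableDilutionRate c φ R ∧ x = (R : EReal)}

/-- The spectral projection `{A ≥ 0}` of a self-adjoint operator `A`. -/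
def nonnegProj {d : ℕ} (A : Matrix (Fin d) (Fin d) ℂ) : Matrix (Fin d) (Fin d) ℂ :=
  cfc (fun x : ℝ => if 0 ≤ x then (1 : ℝ) else 0) A

/-- The difference operator `Π_n(γ) = ρ_n - e^{nγ} ω_n`. -/
def diffOp {d : ℕ → ℕ} (ρ ω : ∀ n, Matrix (Fin (d n)) (Fin (d n)) ℂ) (γ : ℝ) (n : ℕ) :
    Matrix (Fin (d n)) (Fin (d n)) ℂ :=
  ρ n - ((Real.exp (n * γ) : ℝ) : ℂ) • ω n

/-- The quantum spectral inf-divergence rate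
`sup {γ | liminf_n Tr[{Π_n(γ) ≥ 0} Π_n(γ)] = 1}`, as an extended real number. -/
def infDivergenceRate {d : ℕ → ℕ} (ρ ω : ∀ n, Matrix (Fin (d n)) (Fin (d n)) ℂ) : EReal :=
  sSup {x | ∃ γ : ℝ,
    Filter.liminf (fun n : ℕ =>
      (((Matrix.trace (nonnegProj (diffOp ρ ω γ n) * diffOp ρ ω γ n)).re : ℝ) : EReal))
      Filter.atTop = 1 ∧ x = (γ : EReal)}

/-- The sup-spectral entropy rate of a sequence of states: minus the spectral inf-divergence rate
relative to the sequence of identity operators. -/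
def supSpectralEntropyRate {d : ℕ → ℕ} (ρ : ∀ n, Matrix (Fin (d n)) (Fin (d n)) ℂ) : EReal :=
  -infDivergenceRate ρ (fun _ => 1)

end

end EntDilution

open scoped Matrix Kronecker

namespace EntDilution

open scoped ComplexOrder

/-! Write a bipartite vector as its coefficient matrix `Φ`; the reduced state on `B` is `(Φᴴ * Φ)ᵀ`,
whose nonzero eigenvalues are the squared Schmidt coefficients. Let `f(e)` be the trace of the
positive part of this state minus `e`. Both directions are one-shot bounds in terms of `f`, applied
with `e = exp (n γ)`.

Achievability (`exists_dilution`): keep the Schmidt terms with squared coefficient at least `e`.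
These coefficients sum to at most 1, so at most `1 / e` terms survive, and the normalised truncation
has fidelity equal to the kept weight, which is at least `f(e)`. Cyclic shifts of the Schmidt basis
prepare it exactly from a maximally entangled state, with one-way communication in either direction.
If `f(exp (n γ))` tends to 1, then the rate `-γ` is achievable.

Converse (`IsSeparableMap.fidelity_le`): every LOCC map is separable, and each product Kraus
operator sends a vector of local dimension `M` to a coefficient matrix factoring through `M`
dimensions. Its overlap with the target is controlled by `Tr[P ρ]` for a projection `P` of trace at
most `M`, hence by `M e + f(e)`. At an achievable rate `R` and `γ < -R` the term `M e` vanishes,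
which forces `f` to 1. -/

/-! ### Pure states as coefficient matrices. -/

/-- The vector `∑ X i j |i⟩|j⟩` with coefficient matrix `X`. -/
def toVec {a b : ℕ} (X : Matrix (Fin a) (Fin b) ℂ) : BiVec a b :=
  WithLp.toLp 2 fun x => X x.1 x.2

/-- The coefficient matrix of a vector in the product basis. -/
def toMat {a b : ℕ} (φ : BiVec a b) : Matrix (Fin a) (Fin b) ℂ :=
  Matrix.of fun i j => φ (i, j)

@[simp] lemma toVec_toMat {a b : ℕ} (φ : BiVec a b) : toVec (toMat φ) = φ := rfl

lemma traceA_proj_toVec {a b : ℕ} (X : Matrix (Fin a) (Fin b) ℂ) :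
    traceA (proj (toVec X)) = (Xᴴ * X)ᵀ := by
  ext j l
  simp [traceA, proj, toVec, Matrix.mul_apply, mul_comm]

/-- Since `A ⊗ₖ B` maps the vector of `X` to that of `A * X * Bᵀ`, a pure input stays pure in every
Kraus branch, and local operations become left and right multiplication. -/
lemma kronecker_mul_proj_mul {a b a' b' : ℕ} (A : Matrix (Fin a') (Fin a) ℂ)
    (B : Matrix (Fin b') (Fin b) ℂ) (X : Matrix (Fin a) (Fin b) ℂ) :
    (A ⊗ₖ B) * proj (toVec X) * (A ⊗ₖ B)ᴴ = proj (toVec (A * X * Bᵀ)) := by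
  have hp : ∀ {a b : ℕ} (X : Matrix (Fin a) (Fin b) ℂ), proj (toVec X) =
      Matrix.vecMulVec (fun x => X x.1 x.2) (star fun x : Fin a × Fin b => X x.1 x.2) := by
    intro a b X
    ext x y
    simp [proj, toVec, Matrix.vecMulVec_apply]
  have hv : (A ⊗ₖ B) *ᵥ (fun x => X x.1 x.2) = fun x => (A * X * Bᵀ) x.1 x.2 := by
    ext ⟨i, j⟩
    simp only [Matrix.mulVec, dotProduct, Fintype.sum_prod_type, Matrix.mul_apply,
      Matrix.kroneckerMap_apply, Matrix.transpose_apply, Finset.sum_mul]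
    rw [Finset.sum_comm]
    exact Finset.sum_congr rfl fun _ _ => Finset.sum_congr rfl fun _ _ => by ring
  rw [hp, hp, Matrix.mul_vecMulVec, Matrix.vecMulVec_mul, hv, ← hv, Matrix.star_mulVec]

lemma trace_conjTranspose_mul {a b : ℕ} (X Y : Matrix (Fin a) (Fin b) ℂ) :
    (Xᴴ * Y).trace = ∑ x : Fin a × Fin b, star (X x.1 x.2) * Y x.1 x.2 := by
  rw [Fintype.sum_prod_type, Finset.sum_comm]
  simp [Matrix.trace, Matrix.mul_apply]

lemma norm_toVec_sq {a b : ℕ} (X : Matrix (Fin a) (Fin b) ℂ) :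
    ((‖toVec X‖ ^ 2 : ℝ) : ℂ) = (Xᴴ * X).trace := by
  rw [trace_conjTranspose_mul, EuclideanSpace.norm_sq_eq]
  push_cast
  refine Finset.sum_congr rfl fun x _ => ?_
  simpa [toVec] using (Complex.conj_mul' (X x.1 x.2)).symm

lemma fidelity_proj_toVec {a b : ℕ} (X Y : Matrix (Fin a) (Fin b) ℂ) :
    fidelity (proj (toVec X)) (toVec Y) = ‖(Yᴴ * X).trace‖ ^ 2 := by
  have h : (proj (toVec X) * proj (toVec Y)).trace =
      (Yᴴ * X).trace * star (Yᴴ * X).trace := by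
    rw [trace_conjTranspose_mul, star_sum, Finset.sum_mul_sum, Finset.sum_comm]
    simp only [Matrix.trace, Matrix.diag, Matrix.mul_apply]
    rw [Finset.sum_comm]
    refine Finset.sum_congr rfl fun x _ => Finset.sum_congr rfl fun y _ => ?_
    simp [proj, toVec]
    ring
  rw [fidelity, h]
  have := Complex.mul_conj' (Yᴴ * X).trace
  rw [Complex.star_def, this]
  norm_cast

lemma norm_trace_conjTranspose_mul_sq_le {a b : ℕ} (X Y : Matrix (Fin a) (Fin b) ℂ) :
    ‖(Xᴴ * Y).trace‖ ^ 2 ≤ ‖toVec X‖ ^ 2 * ‖toVec Y‖ ^ 2 := by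
  have h : (Xᴴ * Y).trace = inner ℂ (toVec X) (toVec Y) := by
    rw [trace_conjTranspose_mul]
    simp [PiLp.inner_apply, toVec, mul_comm]
  rw [h, ← mul_pow]
  gcongr
  exact norm_inner_le_norm _ _

lemma fidelity_sum {a b : ℕ} {ι : Type*} (s : Finset ι) (σ : ι → BiOp a b) (φ : BiVec a b) :
    fidelity (∑ i ∈ s, σ i) φ = ∑ i ∈ s, fidelity (σ i) φ := by
  simp [fidelity, Finset.sum_mul, Matrix.trace_sum]

/-! ### Separable maps -/

/-- Completely positive trace-preserving maps with product Kraus operators. -/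
def IsSeparableMap {a b a' b' : ℕ} (T : BiOp a b → BiOp a' b') : Prop :=
  ∃ (ι : Type) (_ : Fintype ι) (A : ι → Matrix (Fin a') (Fin a) ℂ)
    (B : ι → Matrix (Fin b') (Fin b) ℂ),
    (∑ i, (A i ⊗ₖ B i)ᴴ * (A i ⊗ₖ B i) = 1) ∧
    ∀ ρ, T ρ = ∑ i, (A i ⊗ₖ B i) * ρ * (A i ⊗ₖ B i)ᴴ

lemma isSeparableMap_id {a b : ℕ} : IsSeparableMap (fun ρ : BiOp a b => ρ) :=
  ⟨Unit, inferInstance, fun _ => 1, fun _ => 1, by simp, by simp⟩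

/-- A separable measurement followed by separable maps depending on its outcome is separable. -/
lemma IsSeparableMap.sum_comp {a b a' b' m : ℕ} {c d : Fin m → ℕ}
    (A : ∀ i, Matrix (Fin (c i)) (Fin a) ℂ) (B : ∀ i, Matrix (Fin (d i)) (Fin b) ℂ)
    (hAB : ∑ i, (A i ⊗ₖ B i)ᴴ * (A i ⊗ₖ B i) = 1)
    {T : ∀ i, BiOp (c i) (d i) → BiOp a' b'} (hT : ∀ i, IsSeparableMap (T i)) :
    IsSeparableMap fun ρ : BiOp a b => ∑ i, T i ((A i ⊗ₖ B i) * ρ * (A i ⊗ₖ B i)ᴴ) := by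
  choose ι hι A' B' hsum hTk using hT
  refine ⟨Σ i, ι i, inferInstance, fun x => A' x.1 x.2 * A x.1, fun x => B' x.1 x.2 * B x.1,
    ?_, fun ρ => ?_⟩
  · rw [Fintype.sum_sigma, ← hAB]
    refine Finset.sum_congr rfl fun i _ => ?_
    have : ∀ j, ((A' i j * A i) ⊗ₖ (B' i j * B i))ᴴ * ((A' i j * A i) ⊗ₖ (B' i j * B i)) =
        (A i ⊗ₖ B i)ᴴ * ((A' i j ⊗ₖ B' i j)ᴴ * (A' i j ⊗ₖ B' i j)) * (A i ⊗ₖ B i) := by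
      intro j
      rw [Matrix.mul_kronecker_mul, Matrix.conjTranspose_mul]
      simp only [Matrix.mul_assoc]
    simp only [this]
    rw [← Matrix.sum_mul, ← Matrix.mul_sum, hsum, Matrix.mul_one]
  · rw [Fintype.sum_sigma]
    refine Finset.sum_congr rfl fun i _ => ?_
    rw [hTk]
    refine Finset.sum_congr rfl fun j _ => ?_
    rw [Matrix.mul_kronecker_mul, Matrix.conjTranspose_mul]
    simp only [Matrix.mul_assoc]

lemma sum_kronecker_one {a b m : ℕ} {c : Fin m → ℕ} (K : ∀ i, Matrix (Fin (c i)) (Fin a) ℂ)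
    (hK : ∑ i, (K i)ᴴ * K i = 1) :
    ∑ i, (K i ⊗ₖ (1 : Matrix (Fin b) (Fin b) ℂ))ᴴ * (K i ⊗ₖ (1 : Matrix (Fin b) (Fin b) ℂ)) =
      1 := by
  have : ∀ i, (K i ⊗ₖ (1 : Matrix (Fin b) (Fin b) ℂ))ᴴ *
      (K i ⊗ₖ (1 : Matrix (Fin b) (Fin b) ℂ)) = ((K i)ᴴ * K i) ⊗ₖ 1 := by
    intro i
    rw [Matrix.conjTranspose_kronecker, ← Matrix.mul_kronecker_mul]
    simp
  simp only [this]
  rw [← Matrix.one_kronecker_one, ← hK]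
  ext
  simp [Matrix.sum_apply, Finset.sum_mul]

lemma sum_one_kronecker {a b m : ℕ} {c : Fin m → ℕ} (L : ∀ i, Matrix (Fin (c i)) (Fin b) ℂ)
    (hL : ∑ i, (L i)ᴴ * L i = 1) :
    ∑ i, ((1 : Matrix (Fin a) (Fin a) ℂ) ⊗ₖ L i)ᴴ * ((1 : Matrix (Fin a) (Fin a) ℂ) ⊗ₖ L i) =
      1 := by
  have : ∀ i, ((1 : Matrix (Fin a) (Fin a) ℂ) ⊗ₖ L i)ᴴ *
      ((1 : Matrix (Fin a) (Fin a) ℂ) ⊗ₖ L i) = 1 ⊗ₖ ((L i)ᴴ * L i) := by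
    intro i
    rw [Matrix.conjTranspose_kronecker, ← Matrix.mul_kronecker_mul]
    simp
  simp only [this]
  rw [← Matrix.one_kronecker_one, ← hL]
  ext
  simp [Matrix.sum_apply, Finset.mul_sum]

/-- Each round is a product measurement with the identity on the silent party, so induction on the
protocol applies. The converse uses no other property of LOCC and so treats all three classes at
once. -/
lemma IsLOCC.isSeparableMap {a b a' b' : ℕ} {T : BiOp a b → BiOp a' b'} (hT : IsLOCC T) :
    IsSeparableMap T := by
  induction hT with
  | finish => exact isSeparableMap_id
  | alice c K hK T _ ih => exact .sum_comp K (fun _ => 1) (sum_kronecker_one K hK) ih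
  | bob c L hL T _ ih => exact .sum_comp (fun _ => 1) L (sum_one_kronecker L hL) ih

lemma IsForwardLOCC.isLOCC {a b a' b' : ℕ} {T : BiOp a b → BiOp a' b'} (hT : IsForwardLOCC T) :
    IsLOCC T := by
  obtain ⟨m, k, K, L, hK, hL, hT⟩ := hT
  have h := IsLOCC.alice (fun _ => a') K hK _ fun i =>
    IsLOCC.bob (fun _ => b') (L i) (hL i) _ fun _ => IsLOCC.finish
  convert h using 1
  ext1 ρ
  rw [hT]
  refine Finset.sum_congr rfl fun i _ => Finset.sum_congr rfl fun j _ => ?_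
  have : K i ⊗ₖ L i j = ((1 : Matrix (Fin a') (Fin a') ℂ) ⊗ₖ L i j) *
      (K i ⊗ₖ (1 : Matrix (Fin b) (Fin b) ℂ)) := by
    rw [← Matrix.mul_kronecker_mul]
    simp
  rw [this, Matrix.conjTranspose_mul]
  simp only [Matrix.mul_assoc]

lemma IsBackwardLOCC.isLOCC {a b a' b' : ℕ} {T : BiOp a b → BiOp a' b'}
    (hT : IsBackwardLOCC T) : IsLOCC T := by
  obtain ⟨m, k, L, K, hL, hK, hT⟩ := hT
  have h := IsLOCC.bob (fun _ => b') L hL _ fun i =>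
    IsLOCC.alice (fun _ => a') (K i) (hK i) _ fun _ => IsLOCC.finish
  convert h using 1
  ext1 ρ
  rw [hT]
  refine Finset.sum_congr rfl fun i _ => Finset.sum_congr rfl fun j _ => ?_
  have : K i j ⊗ₖ L i = (K i j ⊗ₖ (1 : Matrix (Fin b') (Fin b') ℂ)) *
      ((1 : Matrix (Fin a) (Fin a) ℂ) ⊗ₖ L i) := by
    rw [← Matrix.mul_kronecker_mul]
    simp
  rw [this, Matrix.conjTranspose_mul]
  simp only [Matrix.mul_assoc]

lemma Communication.Allows.isSeparableMap {c : Communication} {a b a' b' : ℕ}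
    {T : BiOp a b → BiOp a' b'} (hT : c.Allows T) : IsSeparableMap T := by
  cases c
  · exact (IsForwardLOCC.isLOCC hT).isSeparableMap
  · exact (IsBackwardLOCC.isLOCC hT).isSeparableMap
  · exact IsLOCC.isSeparableMap hT

/-! ### Spectral projections and their variational property. -/

/-- Diagonalization of a Hermitian matrix, with the resulting formula for the trace of its
positive part. -/
lemma exists_diagonalization {d : ℕ} {H : Matrix (Fin d) (Fin d) ℂ} (hH : H.IsHermitian) :
    ∃ (U : Matrix (Fin d) (Fin d) ℂ) (l : Fin d → ℝ), Uᴴ * U = 1 ∧ U * Uᴴ = 1 ∧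
      H = U * Matrix.diagonal (fun i => (l i : ℂ)) * Uᴴ ∧
      (nonnegProj H * H).trace.re = ∑ i, if 0 ≤ l i then l i else 0 := by
  have hU : (hH.eigenvectorUnitary : Matrix (Fin d) (Fin d) ℂ)ᴴ * hH.eigenvectorUnitary = 1 :=
    Unitary.coe_star_mul_self hH.eigenvectorUnitary
  have hU' : (hH.eigenvectorUnitary : Matrix (Fin d) (Fin d) ℂ) * (hH.eigenvectorUnitary.1)ᴴ = 1 :=
    Unitary.coe_mul_star_self hH.eigenvectorUnitary
  have hsp : H = hH.eigenvectorUnitary * Matrix.diagonal (fun i => (hH.eigenvalues i : ℂ)) *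
      (hH.eigenvectorUnitary.1)ᴴ := by
    conv_lhs => rw [hH.spectral_theorem, Unitary.conjStarAlgAut_apply]
    rfl
  refine ⟨hH.eigenvectorUnitary, hH.eigenvalues, hU, hU', hsp, ?_⟩
  have hP : nonnegProj H = hH.eigenvectorUnitary *
      Matrix.diagonal (fun i => ((if 0 ≤ hH.eigenvalues i then (1 : ℝ) else 0 : ℝ) : ℂ)) *
      (hH.eigenvectorUnitary.1)ᴴ := by
    rw [nonnegProj, hH.cfc_eq, Matrix.IsHermitian.cfc, Unitary.conjStarAlgAut_apply]
    rfl
  generalize (hH.eigenvectorUnitary : Matrix (Fin d) (Fin d) ℂ) = U at *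
  generalize hH.eigenvalues = l at *
  have h : nonnegProj H * H = U * Matrix.diagonal
      (fun i => ((if 0 ≤ l i then l i else 0 : ℝ) : ℂ)) * Uᴴ := by
    have hD : Matrix.diagonal (fun i => ((if 0 ≤ l i then (1 : ℝ) else 0 : ℝ) : ℂ)) *
        Matrix.diagonal (fun i => (l i : ℂ)) =
        Matrix.diagonal (fun i => ((if 0 ≤ l i then l i else 0 : ℝ) : ℂ)) := by
      rw [Matrix.diagonal_mul_diagonal]
      congr 1
      ext i
      split_ifs <;> simp
    calc nonnegProj H * H = nonnegProj H * (U * Matrix.diagonal (fun i => (l i : ℂ)) * Uᴴ) := by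
          rw [← hsp]
      _ = U * (Matrix.diagonal (fun i => ((if 0 ≤ l i then (1 : ℝ) else 0 : ℝ) : ℂ)) *
            (Uᴴ * U) * Matrix.diagonal (fun i => (l i : ℂ))) * Uᴴ := by
          rw [hP]
          simp only [Matrix.mul_assoc]
      _ = _ := by rw [hU, Matrix.mul_one, hD]
  rw [h, Matrix.trace_mul_comm, ← Matrix.mul_assoc, hU, Matrix.one_mul, Matrix.trace_diagonal,
    ← Complex.ofReal_sum, Complex.ofReal_re]

/-- The spectral projection `{H ≥ 0}` maximizes `Tr[P H]` over the projections `P`. -/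
lemma re_trace_mul_le_nonnegProj {d : ℕ} {H P : Matrix (Fin d) (Fin d) ℂ} (hH : H.IsHermitian)
    (hP : Pᴴ = P) (hPP : P * P = P) :
    (P * H).trace.re ≤ (nonnegProj H * H).trace.re := by
  obtain ⟨U, l, hU, hU', hHU, htr⟩ := exists_diagonalization hH
  set Q := Uᴴ * P * U with hQ
  have hQs : Qᴴ = Q := by
    simp [hQ, Matrix.conjTranspose_mul, hP, Matrix.mul_assoc]
  have hQQ : Qᴴ * Q = Q := by
    rw [hQs]
    calc Q * Q = Uᴴ * (P * (U * Uᴴ) * P) * U := by simp only [hQ, Matrix.mul_assoc]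
      _ = Q := by rw [hU', Matrix.mul_one, hPP]
  -- `Q` is `P` in the eigenbasis of `H`. Being a projection, it satisfies `Q i i = ∑ k, |Q k i|² ≥
  -- |Q i i|²`, so its diagonal entries are weights in `[0, 1]`; giving weight 1 exactly to the
  -- nonnegative eigenvalues is optimal.
  have hq : ∀ i, 0 ≤ (Q i i).re ∧ (Q i i).re ≤ 1 := by
    intro i
    have h1 : (Q i i).re = ∑ k, Complex.normSq (Q k i) := by
      conv_lhs => rw [← hQQ]
      simp [Matrix.mul_apply, Complex.normSq_apply]
    have h2 : Complex.normSq (Q i i) ≤ ∑ k, Complex.normSq (Q k i) :=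
      Finset.single_le_sum (f := fun k => Complex.normSq (Q k i))
        (fun k _ => Complex.normSq_nonneg _) (Finset.mem_univ i)
    have h3 : (Q i i).re ^ 2 ≤ Complex.normSq (Q i i) := by
      rw [Complex.normSq_apply]
      nlinarith [mul_self_nonneg (Q i i).im]
    have h4 : (Q i i).re ^ 2 ≤ (Q i i).re := by linarith
    constructor <;> nlinarith
  have h : (P * H).trace.re = ∑ i, (Q i i).re * l i := by
    have : (P * H).trace = (Q * Matrix.diagonal (fun i => (l i : ℂ))).trace := by
      rw [hHU, ← Matrix.mul_assoc, Matrix.trace_mul_comm]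
      simp only [hQ, Matrix.mul_assoc]
    rw [this]
    simp [Matrix.trace, Matrix.mul_diagonal]
  rw [h, htr]
  refine Finset.sum_le_sum fun i _ => ?_
  obtain ⟨h0, h1⟩ := hq i
  split_ifs with hl
  · nlinarith
  · nlinarith [not_le.1 hl]

/-- A matrix with `m` columns is fixed by an orthogonal projection of trace at most `m`. -/
lemma exists_projection_mul_eq_self {d m : ℕ} (B : Matrix (Fin d) (Fin m) ℂ) :
    ∃ P : Matrix (Fin d) (Fin d) ℂ, Pᴴ = P ∧ P * P = P ∧ P * B = B ∧ P.trace.re ≤ m := by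
  -- The projection is the one onto the column space of `B`, spanned by the eigenvectors of `B * Bᴴ`
  -- with nonzero eigenvalue; its trace is the rank of `B`.
  have hC : (B * Bᴴ).IsHermitian := Matrix.isHermitian_mul_conjTranspose_self B
  have hU : (hC.eigenvectorUnitary : Matrix (Fin d) (Fin d) ℂ)ᴴ * hC.eigenvectorUnitary = 1 :=
    Unitary.coe_star_mul_self hC.eigenvectorUnitary
  have hsp : B * Bᴴ = hC.eigenvectorUnitary.1 * Matrix.diagonal (fun i => (hC.eigenvalues i : ℂ)) *
      (hC.eigenvectorUnitary.1)ᴴ := by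
    conv_lhs => rw [hC.spectral_theorem, Unitary.conjStarAlgAut_apply]
    rfl
  have hrank : Fintype.card {i // hC.eigenvalues i ≠ 0} ≤ m := by
    rw [← hC.rank_eq_card_non_zero_eigs, Matrix.rank_self_mul_conjTranspose]
    exact B.rank_le_width
  generalize (hC.eigenvectorUnitary : Matrix (Fin d) (Fin d) ℂ) = U at *
  generalize hC.eigenvalues = l at *
  set D : Matrix (Fin d) (Fin d) ℂ := Matrix.diagonal fun i => if l i ≠ 0 then 1 else 0 with hD
  have hmul : ∀ E : Matrix (Fin d) (Fin d) ℂ, U * D * Uᴴ * (U * E * Uᴴ) = U * (D * E) * Uᴴ := by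
    intro E
    calc _ = U * D * (Uᴴ * U) * E * Uᴴ := by simp only [Matrix.mul_assoc]
      _ = _ := by rw [hU, Matrix.mul_one, Matrix.mul_assoc U D E]
  refine ⟨U * D * Uᴴ, ?_, ?_, ?_, ?_⟩
  · have : Dᴴ = D := by
      rw [hD, Matrix.diagonal_conjTranspose]
      congr 1
      ext i
      simp only [Pi.star_apply]
      split_ifs <;> simp
    simp [Matrix.conjTranspose_mul, this, Matrix.mul_assoc]
  · rw [hmul]
    congr 2
    simp [hD]
  · have h0 : (U * D * Uᴴ - 1) * (B * Bᴴ) = 0 := by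
      rw [Matrix.sub_mul, Matrix.one_mul, hsp, hmul, sub_eq_zero]
      congr 2
      rw [hD, Matrix.diagonal_mul_diagonal]
      congr 1
      ext i
      by_cases h : l i = 0 <;> simp [h]
    rw [Matrix.mul_self_mul_conjTranspose_eq_zero, Matrix.sub_mul, Matrix.one_mul,
      sub_eq_zero] at h0
    exact h0
  · rw [Matrix.trace_mul_comm, ← Matrix.mul_assoc, hU, Matrix.one_mul, hD, Matrix.trace_diagonal,
      Finset.sum_boole]
    rw [Fintype.card_subtype] at hrank
    simpa using hrank

/-! ### The one-shot converse. -/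

lemma trace_proj_toVec {a b : ℕ} (X : Matrix (Fin a) (Fin b) ℂ) :
    (proj (toVec X)).trace = ((‖toVec X‖ ^ 2 : ℝ) : ℂ) := by
  rw [norm_toVec_sq, trace_conjTranspose_mul]
  exact Finset.sum_congr rfl fun x _ => by simp [proj, toVec, mul_comm]

lemma isHermitian_sub_smul_one {a b : ℕ} (Φ : Matrix (Fin a) (Fin b) ℂ) (e : ℝ) :
    ((Φᴴ * Φ)ᵀ - (e : ℂ) • (1 : Matrix (Fin b) (Fin b) ℂ)).IsHermitian := by
  refine ((Matrix.isHermitian_conjTranspose_mul_self Φ).transpose).sub ?_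
  ext i j
  by_cases h : i = j <;> simp [h, eq_comm]

/-- The overlap of a vector whose coefficient matrix factors through `m` dimensions on the second
side with a target vector. -/
lemma norm_trace_sq_le_of_factor {a b m : ℕ} (Φ : Matrix (Fin a) (Fin b) ℂ)
    (X : Matrix (Fin a) (Fin m) ℂ) (B : Matrix (Fin b) (Fin m) ℂ) {e : ℝ} (he : 0 ≤ e) :
    ‖(Φᴴ * (X * Bᵀ)).trace‖ ^ 2 ≤
      (m * e + (nonnegProj ((Φᴴ * Φ)ᵀ - (e : ℂ) • 1) * ((Φᴴ * Φ)ᵀ - (e : ℂ) • 1)).trace.re) *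
        ‖toVec (X * Bᵀ)‖ ^ 2 := by
  obtain ⟨P, hP, hPP, hPB, htr⟩ := exists_projection_mul_eq_self B
  have hPt : (Pᵀ)ᴴ = Pᵀ := Matrix.ext fun i j => congrFun₂ hP j i
  -- As `P` fixes `B`, it can be moved onto the target before Cauchy–Schwarz, which leaves `Tr[P ρ]
  -- = Tr[P (ρ - e)] + e Tr P`.
  have h1 : (Φᴴ * (X * Bᵀ)).trace = ((Φ * Pᵀ)ᴴ * (X * Bᵀ)).trace := by
    rw [Matrix.conjTranspose_mul, hPt, Matrix.mul_assoc Pᵀ, Matrix.trace_mul_comm Pᵀ,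
      Matrix.mul_assoc Φᴴ, Matrix.mul_assoc X, ← Matrix.transpose_mul, hPB]
  have h2 : ‖toVec (Φ * Pᵀ)‖ ^ 2 = (P * (Φᴴ * Φ)ᵀ).trace.re := by
    rw [← Complex.ofReal_re (‖toVec (Φ * Pᵀ)‖ ^ 2), norm_toVec_sq]
    congr 1
    rw [Matrix.conjTranspose_mul, hPt, ← Matrix.mul_assoc, Matrix.trace_mul_comm,
      Matrix.mul_assoc, ← Matrix.mul_assoc, ← Matrix.transpose_mul, hPP,
      ← Matrix.trace_transpose, Matrix.transpose_mul, Matrix.transpose_transpose,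
      Matrix.trace_mul_comm]
  have h3 := re_trace_mul_le_nonnegProj (isHermitian_sub_smul_one Φ e) hP hPP
  have h4 : (P * ((Φᴴ * Φ)ᵀ - (e : ℂ) • 1)).trace.re =
      (P * (Φᴴ * Φ)ᵀ).trace.re - e * P.trace.re := by
    simp [Matrix.mul_sub]
  rw [h1]
  refine (norm_trace_conjTranspose_mul_sq_le _ _).trans ?_
  gcongr
  rw [h2]
  nlinarith

/-- Converse bound: the fidelity that separable maps achieve from states of local dimension `m`. -/
lemma IsSeparableMap.fidelity_le {m m' a b : ℕ} {T : BiOp m' m → BiOp a b} (hT : IsSeparableMap T)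
    (X : Matrix (Fin m') (Fin m) ℂ) (hX : ‖toVec X‖ = 1) (Φ : Matrix (Fin a) (Fin b) ℂ)
    {e : ℝ} (he : 0 ≤ e) :
    fidelity (T (proj (toVec X))) (toVec Φ) ≤
      m * e + (nonnegProj ((Φᴴ * Φ)ᵀ - (e : ℂ) • 1) * ((Φᴴ * Φ)ᵀ - (e : ℂ) • 1)).trace.re := by
  obtain ⟨ι, _, A, B, hsum, hT⟩ := hT
  -- Trace preservation: the squared norms of the unnormalised branch vectors are outcome
  -- probabilities.
  have hnorm : ∑ k, ‖toVec (A k * X * (B k)ᵀ)‖ ^ 2 = 1 := by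
    have h : (∑ k, (A k ⊗ₖ B k) * proj (toVec X) * (A k ⊗ₖ B k)ᴴ).trace =
        (proj (toVec X)).trace := by
      rw [Matrix.trace_sum]
      simp_rw [Matrix.mul_assoc, Matrix.trace_mul_comm (A _ ⊗ₖ B _), Matrix.mul_assoc]
      rw [← Matrix.trace_sum, ← Finset.mul_sum, hsum, Matrix.mul_one]
    simp_rw [kronecker_mul_proj_mul, Matrix.trace_sum, trace_proj_toVec, hX] at h
    rw [one_pow] at h
    exact_mod_cast h
  rw [hT, fidelity_sum]
  simp_rw [kronecker_mul_proj_mul, fidelity_proj_toVec]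
  calc _ ≤ ∑ k, _ * ‖toVec (A k * X * (B k)ᵀ)‖ ^ 2 :=
        Finset.sum_le_sum fun k _ => norm_trace_sq_le_of_factor Φ (A k * X) (B k) he
    _ = _ := by rw [← Finset.mul_sum, hnorm, mul_one]

/-! ### Exact preparation from maximally entangled states. -/

lemma maxEntangled_eq_toVec (M : ℕ) :
    maxEntangled M = toVec ((((Real.sqrt M)⁻¹ : ℝ) : ℂ) • (1 : Matrix (Fin M) (Fin M) ℂ)) := by
  ext x
  by_cases h : x.1 = x.2 <;> simp [maxEntangled, toVec, Matrix.one_apply, h]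

lemma norm_maxEntangled {M : ℕ} (hM : 1 ≤ M) : ‖maxEntangled M‖ = 1 := by
  have hM' : (0 : ℝ) < M := by exact_mod_cast hM
  have h : ((‖maxEntangled M‖ ^ 2 : ℝ) : ℂ) = ((1 : ℝ) : ℂ) := by
    rw [maxEntangled_eq_toVec, norm_toVec_sq]
    simp only [Matrix.conjTranspose_smul, Matrix.conjTranspose_one, Matrix.smul_mul,
      Matrix.mul_smul, Matrix.one_mul, Matrix.trace_smul, Matrix.trace_one, Fintype.card_fin,
      Complex.star_def, Complex.conj_ofReal, smul_eq_mul]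
    norm_cast
    rw [← mul_assoc, ← mul_inv, Real.mul_self_sqrt hM'.le, inv_mul_cancel₀ hM'.ne']
  have h' : ‖maxEntangled M‖ ^ 2 = 1 := by exact_mod_cast h
  exact (pow_eq_one_iff_of_nonneg (norm_nonneg _) two_ne_zero).1 h'

/-- The columns of a matrix, cyclically shifted by `s`. -/
def shiftCols {a k : ℕ} (X : Matrix (Fin a) (Fin (k + 1)) ℂ) (s : Fin (k + 1)) :
    Matrix (Fin a) (Fin (k + 1)) ℂ :=
  X.submatrix id (Equiv.addRight s)

/-- `X * Yᵀ` is a sum over paired columns, so a common permutation leaves it unchanged: every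
measurement outcome yields the same state. -/
lemma shiftCols_mul_transpose {a b k : ℕ} (X : Matrix (Fin a) (Fin (k + 1)) ℂ)
    (Y : Matrix (Fin b) (Fin (k + 1)) ℂ) (s : Fin (k + 1)) :
    shiftCols X s * (shiftCols Y s)ᵀ = X * Yᵀ := by
  rw [shiftCols, shiftCols, Matrix.transpose_submatrix, Matrix.submatrix_mul_equiv,
    Matrix.submatrix_id_id]

lemma conjTranspose_shiftCols_mul {a k : ℕ} (X : Matrix (Fin a) (Fin (k + 1)) ℂ)
    (s : Fin (k + 1)) :
    (shiftCols X s)ᴴ * shiftCols X s =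
      (Xᴴ * X).submatrix (Equiv.addRight s) (Equiv.addRight s) := by
  ext i j
  simp [shiftCols, Matrix.mul_apply]

lemma shiftCols_isometry {a k : ℕ} {X : Matrix (Fin a) (Fin (k + 1)) ℂ} (hX : Xᴴ * X = 1)
    (s : Fin (k + 1)) : (shiftCols X s)ᴴ * shiftCols X s = 1 := by
  rw [conjTranspose_shiftCols_mul, hX, Matrix.submatrix_one_equiv]

/-- Over all shifts, each diagonal position receives every `μ i` exactly once. Thus the shifts form
a complete measurement although `X` itself need not be an isometry. -/
lemma sum_shiftCols {a k : ℕ} {X : Matrix (Fin a) (Fin (k + 1)) ℂ} {μ : Fin (k + 1) → ℂ}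
    (hX : Xᴴ * X = Matrix.diagonal μ) (hμ : ∑ i, μ i = 1) :
    ∑ s, (shiftCols X s)ᴴ * shiftCols X s = 1 := by
  simp_rw [conjTranspose_shiftCols_mul, hX]
  ext i j
  rw [Matrix.sum_apply, Matrix.one_apply]
  by_cases h : i = j
  · subst h
    simpa [← hμ] using Equiv.sum_comp (Equiv.addLeft i) μ
  · simp [h]

lemma sum_shiftCols_mul_proj_maxEntangled {a b k : ℕ} (X : Matrix (Fin a) (Fin (k + 1)) ℂ)
    (Y : Matrix (Fin b) (Fin (k + 1)) ℂ) :
    ∑ s, (shiftCols X s ⊗ₖ shiftCols Y s) * proj (maxEntangled (k + 1)) *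
      (shiftCols X s ⊗ₖ shiftCols Y s)ᴴ = proj (toVec (X * Yᵀ)) := by
  simp_rw [maxEntangled_eq_toVec, kronecker_mul_proj_mul, Matrix.mul_smul, Matrix.mul_one,
    Matrix.smul_mul, shiftCols_mul_transpose]
  rw [Finset.sum_const, Finset.card_univ, Fintype.card_fin]
  ext x y
  have h : ((k + 1 : ℕ) : ℂ) * ((((Real.sqrt (k + 1 : ℕ))⁻¹ : ℝ) : ℂ) *
      (((Real.sqrt (k + 1 : ℕ))⁻¹ : ℝ) : ℂ)) = 1 := by
    have hk : (0 : ℝ) < (k + 1 : ℕ) := by positivity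
    norm_cast
    rw [← mul_inv, Real.mul_self_sqrt hk.le, mul_inv_cancel₀ hk.ne']
  generalize (((Real.sqrt (k + 1 : ℕ))⁻¹ : ℝ)) = r at *
  simp only [proj, toVec, Matrix.smul_apply, Matrix.of_apply, smul_eq_mul, nsmul_eq_mul, star_mul',
    Complex.star_def, Complex.conj_ofReal]
  linear_combination ((X * Yᵀ) x.1 x.2 * (starRingEnd ℂ) ((X * Yᵀ) y.1 y.2)) * h

/-- Exact preparation of a pure state of Schmidt rank at most `k + 1` from the maximally entangled
state of rank `k + 1`, with communication from `A` to `B`. -/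
lemma exists_isForwardLOCC {a b k : ℕ} {X : Matrix (Fin a) (Fin (k + 1)) ℂ}
    {Y : Matrix (Fin b) (Fin (k + 1)) ℂ} {μ : Fin (k + 1) → ℂ}
    (hX : Xᴴ * X = Matrix.diagonal μ) (hμ : ∑ i, μ i = 1) (hY : Yᴴ * Y = 1) :
    ∃ T : BiOp (k + 1) (k + 1) → BiOp a b, IsForwardLOCC T ∧
      T (proj (maxEntangled (k + 1))) = proj (toVec (X * Yᵀ)) :=
  -- `B` answers each outcome with a single isometry, hence only one inner Kraus operator.
  ⟨_, ⟨k + 1, 1, shiftCols X, fun s _ => shiftCols Y s, sum_shiftCols hX hμ,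
    fun s => by simpa using shiftCols_isometry hY s, fun _ => rfl⟩,
    by simpa using sum_shiftCols_mul_proj_maxEntangled X Y⟩

/-- Exact preparation of a pure state of Schmidt rank at most `k + 1` from the maximally entangled
state of rank `k + 1`, with communication from `B` to `A`. -/
lemma exists_isBackwardLOCC {a b k : ℕ} {X : Matrix (Fin a) (Fin (k + 1)) ℂ}
    {Y : Matrix (Fin b) (Fin (k + 1)) ℂ} {μ : Fin (k + 1) → ℂ}
    (hX : Xᴴ * X = 1) (hY : Yᴴ * Y = Matrix.diagonal μ) (hμ : ∑ i, μ i = 1) :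
    ∃ T : BiOp (k + 1) (k + 1) → BiOp a b, IsBackwardLOCC T ∧
      T (proj (maxEntangled (k + 1))) = proj (toVec (X * Yᵀ)) :=
  ⟨_, ⟨k + 1, 1, shiftCols Y, fun s _ => shiftCols X s, sum_shiftCols hY hμ,
    fun s => by simpa using shiftCols_isometry hX s, fun _ => rfl⟩,
    by simpa using sum_shiftCols_mul_proj_maxEntangled X Y⟩

/-! ### Schmidt truncation and one-shot achievability. -/

/-- The part of the Schmidt decomposition of `Φ` with squared coefficients at least `e`. -/
lemma exists_truncated_schmidt {a b : ℕ} {Φ : Matrix (Fin a) (Fin b) ℂ} (hΦ : ‖toVec Φ‖ = 1)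
    (e : ℝ)
    (hf : 0 < (nonnegProj ((Φᴴ * Φ)ᵀ - (e : ℂ) • 1) * ((Φᴴ * Φ)ᵀ - (e : ℂ) • 1)).trace.re)
    (he : 0 < e) :
    ∃ (k : ℕ) (G : Matrix (Fin a) (Fin (k + 1)) ℂ) (V : Matrix (Fin b) (Fin (k + 1)) ℂ)
      (l : Fin (k + 1) → ℝ), Gᴴ * G = Matrix.diagonal (fun i => (l i : ℂ)) ∧ Vᴴ * V = 1 ∧
      (∀ i, e ≤ l i) ∧ ∑ i, l i ≤ 1 ∧
      (nonnegProj ((Φᴴ * Φ)ᵀ - (e : ℂ) • 1) * ((Φᴴ * Φ)ᵀ - (e : ℂ) • 1)).trace.re ≤ ∑ i, l i ∧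
      (Φᴴ * (G * Vᵀ)).trace = ((∑ i, l i : ℝ) : ℂ) := by
  obtain ⟨U, l, hU, hU', hH, htr⟩ := exists_diagonalization (isHermitian_sub_smul_one Φ e)
  rw [htr] at hf ⊢
  -- A positive trace means that some coefficient survives, so the kept terms can be indexed by `Fin
  -- (k + 1)`, as the cyclic shifts require.
  have hcard : Fintype.card {i // 0 ≤ l i} ≠ 0 := by
    intro h0
    rw [Fintype.card_eq_zero_iff] at h0
    refine hf.ne' (Finset.sum_eq_zero fun i _ => if_neg fun h => h0.elim ⟨i, h⟩)
  obtain ⟨k, hk⟩ := Nat.exists_eq_succ_of_ne_zero hcard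
  let ε : Fin (k + 1) ≃ {i // 0 ≤ l i} := (Fintype.equivFinOfCardEq hk).symm
  have hinj : Function.Injective fun j => (ε j : Fin b) :=
    Subtype.val_injective.comp ε.injective
  have hsum : ∀ g : Fin b → ℝ, ∑ j, g (ε j) = ∑ i, if 0 ≤ l i then g i else 0 := by
    intro g
    rw [Equiv.sum_comp ε (fun i => g i), ← Finset.sum_filter]
    exact (Finset.sum_subtype _ (by simp) g).symm
  -- The reduced state is the transpose of `Φᴴ * Φ`, so the eigenvectors of the latter are the
  -- entrywise conjugates of the columns of `U`. The columns of `Φ * W` are orthogonal, with squared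
  -- norms `l i + e` because `l` diagonalises the shifted operator.
  set W : Matrix (Fin b) (Fin b) ℂ := (Uᴴ)ᵀ with hW
  have hWU : Wᴴ = Uᵀ := by
    ext i j
    simp [hW]
  have hWW : W * Uᵀ = 1 := by
    rw [hW, ← Matrix.transpose_mul, hU', Matrix.transpose_one]
  have hG : (Φ * W)ᴴ * (Φ * W) = Matrix.diagonal fun i => ((l i + e : ℝ) : ℂ) := by
    have h1 : (Φᴴ * Φ)ᵀ = U * (Matrix.diagonal fun i => ((l i + e : ℝ) : ℂ)) * Uᴴ := by
      rw [sub_eq_iff_eq_add] at hH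
      have h2 : (Matrix.diagonal fun i => ((l i + e : ℝ) : ℂ)) =
          Matrix.diagonal (fun i => (l i : ℂ)) + (e : ℂ) • 1 := by
        ext i j
        by_cases h : i = j <;> simp [h]
      rw [hH, h2, Matrix.mul_add, Matrix.add_mul]
      simp [hU']
    have h3 : Uᴴ * (Φᴴ * Φ)ᵀ * U = Matrix.diagonal fun i => ((l i + e : ℝ) : ℂ) := by
      rw [h1]
      calc _ = (Uᴴ * U) * (Matrix.diagonal fun i => ((l i + e : ℝ) : ℂ)) * (Uᴴ * U) := by
            simp only [Matrix.mul_assoc]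
        _ = _ := by rw [hU, Matrix.one_mul, Matrix.mul_one]
    rw [← Matrix.diagonal_transpose, ← h3, Matrix.conjTranspose_mul, hWU]
    simp only [Matrix.transpose_mul, Matrix.transpose_transpose, hW, Matrix.mul_assoc]
  have hpos : ∀ i, 0 ≤ l i + e := by
    intro i
    have h1 := (Matrix.posSemidef_conjTranspose_mul_self (Φ * W)).diag_nonneg (i := i)
    rw [hG, Matrix.diagonal_apply_eq] at h1
    exact_mod_cast h1
  have htot : ∑ i, (l i + e) = 1 := by
    have h1 : ((Φ * W)ᴴ * (Φ * W)).trace = (Φᴴ * Φ).trace := by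
      rw [Matrix.conjTranspose_mul, hWU, Matrix.mul_assoc, Matrix.trace_mul_comm, Matrix.mul_assoc,
        Matrix.mul_assoc, hWW, Matrix.mul_one]
    rw [hG, ← norm_toVec_sq, hΦ, Matrix.trace_diagonal] at h1
    have h2 : ((∑ i, (l i + e) : ℝ) : ℂ) = ((1 ^ 2 : ℝ) : ℂ) := by
      rw [← h1]
      push_cast
      rfl
    simpa using Complex.ofReal_injective h2
  have hGG : ((Φ * W).submatrix id fun j => (ε j : Fin b))ᴴ *
      (Φ * W).submatrix id (fun j => (ε j : Fin b)) =
      Matrix.diagonal fun j => ((l (ε j) + e : ℝ) : ℂ) := by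
    have : ((Φ * W).submatrix id fun j => (ε j : Fin b))ᴴ *
      (Φ * W).submatrix id (fun j => (ε j : Fin b)) =
        ((Φ * W)ᴴ * (Φ * W)).submatrix (fun j => (ε j : Fin b)) (fun j => (ε j : Fin b)) := by
      ext i j
      simp [Matrix.mul_apply]
    rw [this, hG, Matrix.submatrix_diagonal _ _ hinj]
    rfl
  refine ⟨k, (Φ * W).submatrix id fun j => ε j, U.submatrix id fun j => ε j,
    fun j => l (ε j) + e, hGG, ?_, fun j => ?_, ?_, ?_, ?_⟩
  · have : (U.submatrix id fun j => (ε j : Fin b))ᴴ * U.submatrix id (fun j => (ε j : Fin b)) =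
        (Uᴴ * U).submatrix (fun j => (ε j : Fin b)) (fun j => (ε j : Fin b)) := by
      ext i j
      simp [Matrix.mul_apply]
    rw [this, hU, Matrix.submatrix_one _ hinj]
  · linarith [(ε j).2]
  · rw [hsum fun i => l i + e, ← htot]
    refine Finset.sum_le_sum fun i _ => ?_
    split_ifs
    exacts [le_rfl, hpos i]
  · rw [hsum fun i => l i + e]
    refine Finset.sum_le_sum fun i _ => ?_
    split_ifs <;> linarith
  · have h1 : (U.submatrix id fun j => (ε j : Fin b))ᵀ * Φᴴ =
        ((Φ * W).submatrix id fun j => (ε j : Fin b))ᴴ := by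
      ext i j
      simp [hW, Matrix.mul_apply, mul_comm]
    rw [← Matrix.mul_assoc, Matrix.trace_mul_comm, ← Matrix.mul_assoc, h1, hGG,
      Matrix.trace_diagonal]
    push_cast
    rfl

/-- Achievability: truncating the Schmidt decomposition at squared coefficient `e`. -/
lemma exists_dilution (c : Communication) {a b : ℕ} {Φ : Matrix (Fin a) (Fin b) ℂ}
    (hΦ : ‖toVec Φ‖ = 1) {e : ℝ} (he : 0 < e)
    (hf : 0 < (nonnegProj ((Φᴴ * Φ)ᵀ - (e : ℂ) • 1) * ((Φᴴ * Φ)ᵀ - (e : ℂ) • 1)).trace.re) :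
    ∃ M : ℕ, 1 ≤ M ∧ M * e ≤ 1 ∧ ∃ T : BiOp M M → BiOp a b, c.Allows T ∧
      (nonnegProj ((Φᴴ * Φ)ᵀ - (e : ℂ) • 1) * ((Φᴴ * Φ)ᵀ - (e : ℂ) • 1)).trace.re ≤
        fidelity (T (proj (maxEntangled M))) (toVec Φ) := by
  obtain ⟨k, G, V, l, hG, hV, hl, hl1, hfl, htr⟩ := exists_truncated_schmidt hΦ e hf he
  have hlpos : ∀ i, 0 < l i := fun i => he.trans_le (hl i)
  set s := ∑ i, l i with hs
  have hs0 : 0 < s := hf.trans_le hfl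
  -- `r` normalises the truncated vector, whose squared norm is `s`; its fidelity with the target is
  -- then `r² s² = s`.
  set r : ℝ := (Real.sqrt s)⁻¹ with hr
  have hrs : r * r * s = 1 := by
    rw [hr, ← mul_inv, Real.mul_self_sqrt hs0.le, inv_mul_cancel₀ hs0.ne']
  have hμ : ∑ i, ((r * r * l i : ℝ) : ℂ) = 1 := by
    rw [← Complex.ofReal_sum, ← Finset.mul_sum, ← hs, hrs, Complex.ofReal_one]
  have hfid : fidelity (proj (toVec ((r : ℂ) • (G * Vᵀ)))) (toVec Φ) = s := by
    rw [fidelity_proj_toVec, Matrix.mul_smul, Matrix.trace_smul, htr, smul_eq_mul,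
      ← Complex.ofReal_mul, Complex.norm_real, Real.norm_eq_abs, sq_abs]
    linear_combination s * hrs
  have hM : ((k + 1 : ℕ) : ℝ) * e ≤ 1 := by
    refine le_trans ?_ hl1
    simpa using Finset.card_nsmul_le_sum Finset.univ l e fun i _ => hl i
  have hfwd : ∃ T : BiOp (k + 1) (k + 1) → BiOp a b, IsForwardLOCC T ∧
      T (proj (maxEntangled (k + 1))) = proj (toVec ((r : ℂ) • (G * Vᵀ))) := by
    have hX : ((r : ℂ) • G)ᴴ * ((r : ℂ) • G) =
        Matrix.diagonal fun i => ((r * r * l i : ℝ) : ℂ) := by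
      rw [Matrix.conjTranspose_smul, Matrix.smul_mul, Matrix.mul_smul, hG, smul_smul]
      ext i j
      by_cases h : i = j <;> simp [h]
    simpa only [Matrix.smul_mul] using exists_isForwardLOCC hX hμ hV
  have hbwd : ∃ T : BiOp (k + 1) (k + 1) → BiOp a b, IsBackwardLOCC T ∧
      T (proj (maxEntangled (k + 1))) = proj (toVec ((r : ℂ) • (G * Vᵀ))) := by
    -- The Schmidt weights must sit with the measuring party. For communication from `B` they are
    -- moved from `G` to `V`, which leaves an isometry on the side of `A`.
    have hX : (G * Matrix.diagonal fun i => (((Real.sqrt (l i))⁻¹ : ℝ) : ℂ))ᴴ *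
        (G * Matrix.diagonal fun i => (((Real.sqrt (l i))⁻¹ : ℝ) : ℂ)) = 1 := by
      rw [Matrix.conjTranspose_mul, Matrix.mul_assoc, ← Matrix.mul_assoc Gᴴ, hG,
        Matrix.diagonal_conjTranspose, Matrix.diagonal_mul_diagonal, Matrix.diagonal_mul_diagonal,
        ← Matrix.diagonal_one]
      congr 1
      ext i
      have h1 : (Real.sqrt (l i))⁻¹ * (l i * (Real.sqrt (l i))⁻¹) = 1 := by
        have := Real.sqrt_pos.2 (hlpos i)
        field_simp
        exact (Real.sq_sqrt (hlpos i).le).symm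
      rw [Pi.star_apply, Complex.star_def, Complex.conj_ofReal, ← Complex.ofReal_mul,
        ← Complex.ofReal_mul, h1, Complex.ofReal_one]
    have hY : (V * Matrix.diagonal fun i => ((r * Real.sqrt (l i) : ℝ) : ℂ))ᴴ *
        (V * Matrix.diagonal fun i => ((r * Real.sqrt (l i) : ℝ) : ℂ)) =
        Matrix.diagonal fun i => ((r * r * l i : ℝ) : ℂ) := by
      rw [Matrix.conjTranspose_mul, Matrix.mul_assoc, ← Matrix.mul_assoc Vᴴ, hV, Matrix.one_mul,
        Matrix.diagonal_conjTranspose, Matrix.diagonal_mul_diagonal]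
      congr 1
      ext i
      rw [Pi.star_apply, Complex.star_def, Complex.conj_ofReal, ← Complex.ofReal_mul]
      congr 1
      linear_combination r * r * Real.mul_self_sqrt (hlpos i).le
    have hXY : (G * Matrix.diagonal fun i => (((Real.sqrt (l i))⁻¹ : ℝ) : ℂ)) *
        (V * Matrix.diagonal fun i => ((r * Real.sqrt (l i) : ℝ) : ℂ))ᵀ =
        (r : ℂ) • (G * Vᵀ) := by
      rw [Matrix.transpose_mul, Matrix.diagonal_transpose, Matrix.mul_assoc, ← Matrix.mul_assoc
        (Matrix.diagonal _), Matrix.diagonal_mul_diagonal]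
      have : (Matrix.diagonal fun i => (((Real.sqrt (l i))⁻¹ : ℝ) : ℂ) *
          ((r * Real.sqrt (l i) : ℝ) : ℂ)) = (r : ℂ) • (1 : Matrix (Fin (k + 1)) _ ℂ) := by
        rw [← Matrix.diagonal_one, ← Matrix.diagonal_smul]
        congr 1
        ext i
        rw [Pi.smul_apply, smul_eq_mul, mul_one, ← Complex.ofReal_mul]
        congr 1
        have := Real.sqrt_pos.2 (hlpos i)
        field_simp
      rw [this, Matrix.smul_mul, Matrix.one_mul, Matrix.mul_smul]
    simpa only [hXY] using exists_isBackwardLOCC hX hY hμ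
  refine ⟨k + 1, Nat.le_add_left 1 k, hM, ?_⟩
  cases c
  · obtain ⟨T, hT, hTe⟩ := hfwd
    exact ⟨T, hT, by rw [hTe, hfid]; exact hfl⟩
  · obtain ⟨T, hT, hTe⟩ := hbwd
    exact ⟨T, hT, by rw [hTe, hfid]; exact hfl⟩
  · obtain ⟨T, hT, hTe⟩ := hfwd
    exact ⟨T, hT.isLOCC, by rw [hTe, hfid]; exact hfl⟩

/-! ### Asymptotics and rates. -/

/-- The quantity `Tr[{Π_n(γ) ≥ 0} Π_n(γ)]` for the reduced states of the vectors `φ n`. -/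
noncomputable def reducedPosTrace {a b : ℕ → ℕ} (φ : ∀ n, BiVec (a n) (b n)) (γ : ℝ) (n : ℕ) : ℝ :=
  (Matrix.trace (nonnegProj (diffOp (fun n => traceA (proj (φ n))) (fun _ => 1) γ n) *
    diffOp (fun n => traceA (proj (φ n))) (fun _ => 1) γ n)).re

variable {a b : ℕ → ℕ} {φ : ∀ n, BiVec (a n) (b n)}

lemma reducedPosTrace_eq (γ : ℝ) (n : ℕ) :
    reducedPosTrace φ γ n =
      (nonnegProj (((toMat (φ n))ᴴ * toMat (φ n))ᵀ - ((Real.exp (n * γ) : ℝ) : ℂ) • 1) *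
        (((toMat (φ n))ᴴ * toMat (φ n))ᵀ - ((Real.exp (n * γ) : ℝ) : ℂ) • 1)).trace.re := by
  rw [← traceA_proj_toVec, toVec_toMat]
  rfl

lemma reducedPosTrace_le_one {n : ℕ} (hφ : ‖φ n‖ = 1) (γ : ℝ) : reducedPosTrace φ γ n ≤ 1 := by
  by_cases hf : 0 < reducedPosTrace φ γ n
  · rw [reducedPosTrace_eq] at hf ⊢
    obtain ⟨k, G, V, l, -, -, -, hl1, hfl, -⟩ :=
      exists_truncated_schmidt (Φ := toMat (φ n)) hφ _ hf (Real.exp_pos _)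
    exact hfl.trans hl1
  · linarith

/-- The condition in the spectral inf-divergence rate, without extended reals. -/
lemma liminf_reducedPosTrace_eq_one_iff (hφ : ∀ n, 1 ≤ n → ‖φ n‖ = 1) (γ : ℝ) :
    Filter.liminf (fun n => (reducedPosTrace φ γ n : EReal)) Filter.atTop = 1 ↔
      ∀ ε : ℝ, 0 < ε → ∀ᶠ n in Filter.atTop, 1 - ε < reducedPosTrace φ γ n := by
  -- The values with `n ≥ 1` never exceed 1, so only the lower bound on the limit inferior carries
  -- information.
  have hle : Filter.liminf (fun n => (reducedPosTrace φ γ n : EReal)) Filter.atTop ≤ 1 := by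
    refine Filter.liminf_le_of_frequently_le' (Filter.Eventually.frequently ?_)
    filter_upwards [Filter.eventually_ge_atTop 1] with n hn
    exact_mod_cast reducedPosTrace_le_one (hφ n hn) γ
  constructor
  · intro h ε hε
    have h1 : ((1 - ε : ℝ) : EReal) <
        Filter.liminf (fun n => (reducedPosTrace φ γ n : EReal)) Filter.atTop := by
      rw [h]
      exact_mod_cast sub_lt_self 1 hε
    filter_upwards [Filter.eventually_lt_of_lt_liminf h1] with n hn
    exact_mod_cast hn
  · intro h
    refine le_antisymm hle (le_of_forall_lt fun x hx => ?_)
    obtain ⟨y, hxy, hy⟩ := EReal.lt_iff_exists_real_btwn.1 hx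
    have hy' : y < 1 := by exact_mod_cast hy
    refine hxy.trans_le (Filter.le_liminf_of_le (by isBoundedDefault) ?_)
    filter_upwards [h (1 - y) (by linarith)] with n hn
    rw [EReal.coe_le_coe_iff]
    linarith

lemma isAchievableDilutionRate_neg (c : Communication) (hφ : ∀ n, 1 ≤ n → ‖φ n‖ = 1) {γ : ℝ}
    (hγ : ∀ ε : ℝ, 0 < ε → ∀ᶠ n in Filter.atTop, 1 - ε < reducedPosTrace φ γ n) :
    IsAchievableDilutionRate c φ (-γ) := by
  intro ε hε
  -- Capping `ε` at 1 keeps the trace positive, so that the truncation is nonempty.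
  obtain ⟨N, hN⟩ := Filter.eventually_atTop.1 (hγ (min ε 1) (by positivity))
  refine ⟨N, fun n hn hNn => ?_⟩
  have h := hN n hNn
  have hpos : 0 < reducedPosTrace φ γ n := by linarith [min_le_right ε 1]
  rw [reducedPosTrace_eq] at h hpos
  obtain ⟨M, hM, hMe, T, hT, hfid⟩ :=
    exists_dilution c (Φ := toMat (φ n)) (hφ n hn) (Real.exp_pos _) hpos
  have hn0 : (0 : ℝ) < n := by exact_mod_cast hn
  have hM0 : (0 : ℝ) < M := by exact_mod_cast hM
  refine ⟨M, hM, ?_, T, hT, ?_⟩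
  · have h1 := Real.log_le_log (by positivity) hMe
    rw [Real.log_mul hM0.ne' (Real.exp_pos _).ne', Real.log_exp, Real.log_one] at h1
    rw [one_div, inv_mul_le_iff₀ hn0]
    linarith
  · rw [toVec_toMat] at hfid
    linarith [min_le_left ε 1]

/-- From `M ≤ exp (n R)`, the error term `M exp (n γ)` is at most `exp (n (R + γ))`, which tends to
0. Half of `ε` pays for it and half for the infidelity. -/
lemma IsAchievableDilutionRate.reducedPosTrace_gt {c : Communication} {R γ : ℝ}
    (hR : IsAchievableDilutionRate c φ R) (hγ : γ < -R) {ε : ℝ} (hε : 0 < ε) :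
    ∀ᶠ n in Filter.atTop, 1 - ε < reducedPosTrace φ γ n := by
  obtain ⟨N, hN⟩ := hR (ε / 2) (by positivity)
  have hexp : Filter.Tendsto (fun n : ℕ => Real.exp (n * (R + γ))) Filter.atTop (nhds 0) :=
    Real.tendsto_exp_atBot.comp
      (tendsto_natCast_atTop_atTop.atTop_mul_const_of_neg (by linarith))
  filter_upwards [Filter.eventually_ge_atTop N, Filter.eventually_ge_atTop 1,
    hexp.eventually_lt_const (half_pos hε)] with n hNn hn hlt
  obtain ⟨M, hM, hMR, T, hT, hfid⟩ := hN n hn hNn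
  have hn0 : (0 : ℝ) < n := by exact_mod_cast hn
  have hM0 : (0 : ℝ) < M := by exact_mod_cast hM
  have hme := norm_maxEntangled hM
  rw [maxEntangled_eq_toVec] at hme hfid
  have h := hT.isSeparableMap.fidelity_le _ hme (toMat (φ n)) (Real.exp_pos (n * γ)).le
  rw [toVec_toMat, ← reducedPosTrace_eq] at h
  have hMexp : (M : ℝ) ≤ Real.exp (n * R) := by
    rw [← Real.log_le_iff_le_exp hM0]
    rwa [one_div, inv_mul_le_iff₀ hn0] at hMR
  have : M * Real.exp (n * γ) ≤ Real.exp (n * (R + γ)) := by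
    rw [mul_add, Real.exp_add]
    gcongr
  linarith

end EntDilution

/-- The entanglement cost of an arbitrary sequence of bipartite pure states, under LOCC with
one-way communication in either direction or with two-way communication, equals the sup-spectral
entropy rate of the sequence of reduced states. -/
theorem mainTheorem1 (c : EntDilution.Communication) (a b : ℕ → ℕ)
    (φ : ∀ n, EntDilution.BiVec (a n) (b n)) (hφ : ∀ n, 1 ≤ n → ‖φ n‖ = 1) :
    EntDilution.entanglementCost c φ =
      EntDilution.supSpectralEntropyRate
        (fun n => EntDilution.traceA (EntDilution.proj (φ n))) := by
  rw [EntDilution.supSpectralEntropyRate, EntDilution.entanglementCost,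
    EntDilution.infDivergenceRate]
  refine le_antisymm (EReal.le_neg_of_le_neg (sSup_le ?_)) (le_sInf ?_)
  · rintro _ ⟨γ, hγ, rfl⟩
    refine EReal.le_neg_of_le_neg (sInf_le ⟨-γ, ?_, (EReal.coe_neg γ).symm⟩)
    exact EntDilution.isAchievableDilutionRate_neg c hφ
      ((EntDilution.liminf_reducedPosTrace_eq_one_iff hφ γ).1 hγ)
  · rintro _ ⟨R, hR, rfl⟩
    -- The one-shot converse needs `γ` strictly below `-R`, so `-R` is approached from below by real
    -- numbers.
    refine EReal.neg_le_of_neg_le (le_of_forall_lt fun x hx => ?_)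
    obtain ⟨γ, hxγ, hγ⟩ := EReal.lt_iff_exists_real_btwn.1 hx
    rw [← EReal.coe_neg, EReal.coe_lt_coe_iff] at hγ
    exact hxγ.trans_le (le_sSup ⟨γ, (EntDilution.liminf_reducedPosTrace_eq_one_iff hφ γ).2
      fun ε hε => hR.reducedPosTrace_gt hγ hε, rfl⟩)
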